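/- Let $F:\mathbb{R}^2\to\mathbb{R}$ satisfy $F(t+1,x)=F(t,x)$ and suppose that $\dot x=F(t,x)$ has existence and uniqueness of solutions (in the sense of Carathéodory, i.e. $x(s)=x(t_0)+\int_{t_0}^{s}F(u,x(u))\,du$ with integrable integrand) for every initial condition $(t_0,x_0)$. Let $x(\cdot;t,0)$ be the solution with $x(t;t,0)=0$, and suppose that for every $t\in\mathbb{R}$ it reaches the value $1$ at some time later than $t$, so that the firing map $\Phi(t)=\inf\{s>t:\ x(s;t,0)\ge 1\}$ is defined on all of $\mathbb{R}$; it satisfies $\Phi(t+1)=\Phi(t)+1$. Suppose that - $\Phi$ is a $C^1$-diffeomorphism of $\mathbb{R}$ with irrational rotation number $\varrho=\lim_{n\to\infty}\Phi^n(t)/n$; - there is a $C^1$-diffeomorphism $\Gamma$ of $\mathbb{R}$ with $\Gamma(t+1)=\Gamma(t)+1$ and $\Gamma(\Phi(t))=\Gamma(t)+\varrho$ for all $t$; - the set $\mathcal{C}_\Psi=\{t\in[0,1]:\ \Psi'(t)=0\}$ of critical points of the displacement function $\Psi(t)=\Phi(t)-t$, $t\in[0,1]$, has Lebesgue measure $0$.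 Then the circle map $\varphi=\Phi \bmod 1$ on $\mathbb{R}/\mathbb{Z}$ has a unique invariant Borel probability measure $\mu$, and the interspike-interval distribution $\mu_{\mathrm{ISI}}(A)=\mu(\{t\in[0,1):\ \Phi(t)-t\in A\})$, $A\subset\mathbb{R}$ Borel, is absolutely continuous with respect to Lebesgue measure on $\mathbb{R}$, with density (defined up to null sets) $$\Delta(y)=\begin{cases}0 & \text{if } y\notin\operatorname{supp}(\mu_{\mathrm{ISI}}),\\[2pt] \displaystyle\sum_{t\in[0,1],\ \Psi(t)=y}\frac{\Gamma'(t)}{|\Phi'(t)-1|} & \text{if } y\in\operatorname{supp}(\mu_{\mathrm{ISI}}).\end{cases}$$ The set $V(\mathcal{C}_\Psi)=\Psi(\mathcal{C}_\Psi)$ of critical values has Lebesgue measure $0$, and for every $y\in\operatorname{supp}(\mu_{\mathrm{ISI}})\setminus V(\mathcal{C}_\Psi)$ the sum is well-defined: it has finitely many terms, with non-zero denominators. -/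

import Mathlib

open Set Filter Topology MeasureTheory

noncomputable section

namespace IntegrateFire

/-- `x` solves `ẋ = F(t, x)` on `[a, b]` in the sense of Carathéodory: `u ↦ F(u, x(u))` is
integrable and `x` is its indefinite integral. For continuous `F` these are exactly the
classical solutions; the notion also covers locally integrable inputs. -/
def IsSolutionOn (F : ℝ → ℝ → ℝ) (x : ℝ → ℝ) (a b : ℝ) : Prop :=
  IntervalIntegrable (fun u => F u (x u)) volume a b ∧
    ∀ s ∈ Icc a b, x s = x a + ∫ u in a..s, F u (x u)

/-- Existence (locally, forward in time) and uniqueness of the solution of `ẋ = F(t, x)` for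
every initial condition `(t₀, x₀)`. -/
def WellPosed (F : ℝ → ℝ → ℝ) : Prop :=
  (∀ t₀ x₀ : ℝ, ∃ s > t₀, ∃ x : ℝ → ℝ, IsSolutionOn F x t₀ s ∧ x t₀ = x₀) ∧
  (∀ (t₀ s : ℝ) (x y : ℝ → ℝ), IsSolutionOn F x t₀ s → IsSolutionOn F y t₀ s →
    x t₀ = y t₀ → EqOn x y (Icc t₀ s))

/-- The natural domain of the firing map: those `t` for which the solution started at the reset
value `0` at time `t` reaches the threshold `1` at some later time. -/
def firingDomain (F : ℝ → ℝ → ℝ) : Set ℝ :=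
  {t | ∃ s > t, ∃ x : ℝ → ℝ, IsSolutionOn F x t s ∧ x t = 0 ∧ x s = 1}

/-- The firing map `Φ(t) = inf {s > t : x(s; t, 0) ≥ 1}`. -/
def firingMap (F : ℝ → ℝ → ℝ) (t : ℝ) : ℝ :=
  sInf {s | t < s ∧ ∃ x : ℝ → ℝ, IsSolutionOn F x t s ∧ x t = 0 ∧ 1 ≤ x s}

/-- `f` is a `C¹`-diffeomorphism of the real line onto itself. -/
def IsC1Diffeo (f : ℝ → ℝ) : Prop :=
  ContDiff ℝ 1 f ∧ ∃ g : ℝ → ℝ, ContDiff ℝ 1 g ∧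
    Function.LeftInverse g f ∧ Function.RightInverse g f

/-- `ρ` is the rotation number of `Φ`: `Φⁿ(t) / n → ρ` for every `t`. -/
def HasRotationNumber (Φ : ℝ → ℝ) (ρ : ℝ) : Prop :=
  ∀ t : ℝ, Tendsto (fun n : ℕ => Φ^[n] t / (n : ℝ)) atTop (𝓝 ρ)

/-- The representative in `[0, 1)` of a point of the circle `ℝ / ℤ`. -/
def rep (z : UnitAddCircle) : ℝ := (AddCircle.equivIco (1 : ℝ) 0 z : ℝ)

/-- The circle map `φ = Φ mod 1` (the firing phase map) of a lift `Φ`. -/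
def phaseMap (Φ : ℝ → ℝ) (z : UnitAddCircle) : UnitAddCircle :=
  ((Φ (rep z) : ℝ) : UnitAddCircle)

/-- `μ` is a Borel probability measure on the circle invariant under `φ = Φ mod 1`. -/
def IsInvariantProb (Φ : ℝ → ℝ) (μ : Measure UnitAddCircle) : Prop :=
  IsProbabilityMeasure μ ∧ MeasurePreserving (phaseMap Φ) μ μ

/-- The displacement function `Ψ(t) = Φ(t) - t`. -/
def displacement (Φ : ℝ → ℝ) (t : ℝ) : ℝ := Φ t - t

/-- The interspike-interval distribution: the image of `μ` under `Ψ`, i.e.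
`A ↦ μ {t ∈ [0, 1) : Φ(t) - t ∈ A}`. -/
def isiDistribution (Φ : ℝ → ℝ) (μ : Measure UnitAddCircle) : Measure ℝ :=
  μ.map (fun z => displacement Φ (rep z))

/-- The critical points of `Ψ` in `[0, 1]`. -/
def criticalSet (Φ : ℝ → ℝ) : Set ℝ :=
  {t | t ∈ Icc (0 : ℝ) 1 ∧ deriv (displacement Φ) t = 0}

/-- The critical values of `Ψ` restricted to `[0, 1]`. -/
def criticalValues (Φ : ℝ → ℝ) : Set ℝ := displacement Φ '' criticalSet Φ

/-- The fibre `Ψ⁻¹(y)` of `Ψ` restricted to `[0, 1]`. -/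
def fibre (Φ : ℝ → ℝ) (y : ℝ) : Set ℝ :=
  {t | t ∈ Icc (0 : ℝ) 1 ∧ displacement Φ t = y}

open Classical in
/-- The function `Δ`: on the support of `m` it is `∑_{t ∈ Ψ⁻¹(y)} Γ'(t) / |Φ'(t) - 1|`, and it
vanishes off the support. -/
def isiDensity (Φ Γ : ℝ → ℝ) (m : Measure ℝ) (y : ℝ) : ℝ :=
  if y ∈ m.support then ∑' t : fibre Φ y, deriv Γ t * (1 / |deriv Φ t - 1|) else 0

end IntegrateFire

end

namespace IntegrateFire

/-! The conjugacy `Γ` carries the circle map to the rotation by `ρ`, and pushing forward along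
`phaseMap Γ` is injective on measures. An invariant probability measure thus becomes a
rotation-invariant one. The translations fixing a finite measure form a closed set, here containing
the dense orbit `ℤρ`, so this measure is Haar. Pulling Haar back gives `Γ'(t) dt`
(`isInvariantProb_iff_eq_phaseMeasure`).

The interval distribution is then the image of `Γ'(t) dt` under `Ψ`. Once the null critical set is
discarded, the area formula `map_withDensity_restrict_eq_tsum_fibre` gives the density as a sum over
fibres, with `Ψ' = Φ' - 1`. Exceptional values of `y` (critical values, the endpoint value) form a
null set, and the cutoff to the support changes the density only on a null set (`isiDensity_spec`).
-/

/-! ### Unique ergodicity of irrational rotations -/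

/-- The translations preserving a finite measure form a closed set. -/
theorem isClosed_setOf_map_add_right_eq (ν : Measure UnitAddCircle) [IsFiniteMeasure ν] :
    IsClosed {c : UnitAddCircle | ν.map (· + c) = ν} := by
  -- Finite measures are separated by bounded continuous functions, so the set is an intersection of
  -- conditions continuous in `c`.
  have key : {c : UnitAddCircle | ν.map (· + c) = ν} =
      ⋂ f : BoundedContinuousFunction UnitAddCircle ℝ,
        {c | ∫ x, f (x + c) ∂ν = ∫ x, f x ∂ν} := by
    ext c
    have hmap (f : BoundedContinuousFunction UnitAddCircle ℝ) :
        ∫ x, f x ∂(ν.map (· + c)) = ∫ x, f (x + c) ∂ν :=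
      integral_map (measurable_add_const c).aemeasurable
        f.continuous.aestronglyMeasurable
    simp only [mem_ofPred_eq, mem_iInter]
    refine ⟨fun h f => ?_, fun h => ?_⟩
    · rw [← hmap, h]
    · exact ext_of_forall_integral_eq_of_IsFiniteMeasure fun f => by rw [hmap, h f]
  rw [key]
  refine isClosed_iInter fun f => isClosed_eq ?_ continuous_const
  have hc : Continuous (Function.uncurry fun c x : UnitAddCircle => f (x + c)) := by
    simp only [Function.uncurry_def]
    fun_prop
  simpa using continuous_parametric_integral_of_continuous (μ := ν) hc isCompact_univ

/-- A probability measure invariant under an irrational rotation is the Haar measure. -/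
theorem eq_volume_of_map_add_irrational {ρ : ℝ} (hρ : Irrational ρ)
    {ν : Measure UnitAddCircle} [IsProbabilityMeasure ν]
    (h : ν.map (· + (ρ : UnitAddCircle)) = ν) : ν = volume := by
  have hnat (n : ℤ) : ν.map (· + n • (ρ : UnitAddCircle)) = ν := by
    have hcomp (a b : UnitAddCircle) :
        ν.map (· + (a + b)) = (ν.map (· + a)).map (· + b) := by
      rw [Measure.map_map (measurable_add_const b) (measurable_add_const a)]
      congr 1
      ext x
      simp [add_assoc]
    induction n with
    | zero => simp
    | succ n ih => rw [add_smul, one_smul, hcomp, ih, h]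
    | pred n ih =>
      -- Translating by `-nρ` is translating by `ρ`, which `h` absorbs, and then by `-(n+1)ρ`.
      conv_rhs => rw [← ih]
      rw [show (-(n : ℤ)) • (ρ : UnitAddCircle)
        = (ρ : UnitAddCircle) + (-(n : ℤ) - 1) • (ρ : UnitAddCircle) by
          rw [sub_smul, one_smul]; abel, hcomp, h]
  have hall (c : UnitAddCircle) : ν.map (· + c) = ν := by
    have hd : DenseRange (· • (ρ : UnitAddCircle) : ℤ → UnitAddCircle) :=
      AddCircle.denseRange_zsmul_coe_iff.2 (by simpa using hρ)
    have hsub := (isClosed_setOf_map_add_right_eq ν).closure_subset_iff.2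
      (range_subset_iff.2 hnat)
    rw [hd.closure_range] at hsub
    exact hsub (mem_univ c)
  have : ν.IsAddLeftInvariant := ⟨fun c => by simpa only [add_comm c] using hall c⟩
  have : ν.IsAddHaarMeasure :=
    Measure.isAddHaarMeasure_of_isCompact_nonempty_interior ν univ isCompact_univ (by simp)
      (by simp) (by simp)
  have : IsProbabilityMeasure (volume : Measure UnitAddCircle) := ⟨by simp⟩
  exact Measure.isAddHaarMeasure_eq_of_isProbabilityMeasure _ _

/-! ### Circle maps of degree one -/

theorem coe_rep (z : UnitAddCircle) : ((rep z : ℝ) : UnitAddCircle) = z :=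
  AddCircle.coe_equivIco

theorem measurable_rep : Measurable rep :=
  measurable_subtype_coe.comp (AddCircle.measurableEquivIco 1 0).measurable

/-- `rep t` and `t` differ by an integer; this makes the choice of representative immaterial. -/
theorem periodic_apply_rep {β : Type*} {h : ℝ → β} (hh : Function.Periodic h 1) (t : ℝ) :
    h (rep t) = h t := by
  have h0 : ((rep t - t : ℝ) : UnitAddCircle) = 0 := by
    rw [AddCircle.coe_sub, coe_rep, sub_self]
  obtain ⟨n, hn⟩ := (AddCircle.coe_eq_zero_iff (1 : ℝ)).1 h0
  rw [show rep t = t + n • (1 : ℝ) by rw [hn]; ring]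
  exact hh.zsmul n t

theorem measurable_phaseMap {f : ℝ → ℝ} (hf : Measurable f) : Measurable (phaseMap f) :=
  AddCircle.measurable_mk'.comp (hf.comp measurable_rep)

theorem phaseMap_coe {f : ℝ → ℝ} (hf : ∀ t, f (t + 1) = f t + 1) (t : ℝ) :
    phaseMap f (t : UnitAddCircle) = (f t : UnitAddCircle) := by
  refine periodic_apply_rep (h := fun t => (f t : UnitAddCircle)) (fun t => ?_) t
  simp only [hf, AddCircle.coe_add, AddCircle.coe_period, add_zero]

theorem phaseMap_phaseMap {f : ℝ → ℝ} (hf : ∀ t, f (t + 1) = f t + 1) (g : ℝ → ℝ)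
    (z : UnitAddCircle) : phaseMap f (phaseMap g z) = phaseMap (f ∘ g) z :=
  phaseMap_coe hf _

/-! ### The area formula on the line -/

/-- Change of variables along an injective piece: the sum over a fibre has at most one term. -/
theorem map_withDensity_restrict_of_injOn {Ψ Ψ' : ℝ → ℝ} {V : Set ℝ} (hV : MeasurableSet V)
    (hΨ : Continuous Ψ) (hd : ∀ t ∈ V, HasDerivAt Ψ (Ψ' t) t) (hd0 : ∀ t ∈ V, Ψ' t ≠ 0)
    (hΨ' : Measurable Ψ') (hinj : InjOn Ψ V) {g : ℝ → ENNReal} (hg : Measurable g) :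
    Measurable (fun y => ∑' t : ↥(V ∩ Ψ ⁻¹' {y}), g t / ENNReal.ofReal |Ψ' t|) ∧
    ((volume.restrict V).withDensity g).map Ψ = volume.withDensity
      (fun y => ∑' t : ↥(V ∩ Ψ ⁻¹' {y}), g t / ENNReal.ofReal |Ψ' t|) := by
  set k : ℝ → ENNReal := fun t => g t / ENNReal.ofReal |Ψ' t| with hk
  set h : ℝ → ENNReal := fun y => ∑' t : ↥(V ∩ Ψ ⁻¹' {y}), k t with hh
  have hkm : Measurable k := by fun_prop
  have hin (t : ℝ) (ht : t ∈ V) : h (Ψ t) = k t := by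
    have : V ∩ Ψ ⁻¹' {Ψ t} = {t} := by
      ext s
      exact ⟨fun hs => hinj hs.1 ht hs.2, fun hs => by rw [hs]; exact ⟨ht, rfl⟩⟩
    exact (tsum_congr_set_coe k this).trans (tsum_singleton t k)
  have hout (y : ℝ) (hy : y ∉ Ψ '' V) : h y = 0 := by
    have : V ∩ Ψ ⁻¹' {y} = ∅ := by
      ext s
      simp only [mem_inter_iff, mem_preimage, mem_singleton_iff, mem_empty_iff_false, iff_false]
      exact fun hs => hy ⟨s, hs.1, hs.2⟩
    exact (tsum_congr_set_coe k this).trans tsum_empty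
  have hemb := hΨ.continuousOn.measurableEmbedding hV hinj
  have hm : Measurable h := by
    -- Measurability: `h` extends `k` by zero along the measurable embedding `Ψ|V`.
    have : h = Function.extend (V.domRestrict Ψ) (fun t => k t) (fun _ => 0) := by
      ext y
      by_cases hy : y ∈ Ψ '' V
      · obtain ⟨t, ht, rfl⟩ := hy
        rw [hin t ht]
        exact (hemb.injective.extend_apply (fun t : V => k t) (fun _ => 0) ⟨t, ht⟩).symm
      · rw [hout y hy, Function.extend_apply']
        rintro ⟨t, rfl⟩
        exact hy ⟨t, t.2, rfl⟩
    rw [this]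
    exact hemb.measurable_extend (hkm.comp measurable_subtype_coe) measurable_const
  refine ⟨hm, ?_⟩
  ext A hA
  have hA' : MeasurableSet (Ψ ⁻¹' A) := hΨ.measurable hA
  have hs : MeasurableSet (Ψ ⁻¹' A ∩ V) := hA'.inter hV
  rw [Measure.map_apply hΨ.measurable hA, withDensity_apply _ hA', withDensity_apply _ hA,
    Measure.restrict_restrict hA']
  have hA2 : MeasurableSet (Ψ '' V) := by
    simpa [range_domRestrict] using hemb.measurableSet_range
  calc ∫⁻ t in Ψ ⁻¹' A ∩ V, g t
      = ∫⁻ t in Ψ ⁻¹' A ∩ V, ENNReal.ofReal |Ψ' t| * h (Ψ t) := by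
        refine setLIntegral_congr_fun hs fun t ht => ?_
        simp only [hin t ht.2, hk]
        rw [ENNReal.mul_div_cancel (by simpa using hd0 t ht.2) ENNReal.ofReal_ne_top]
    _ = ∫⁻ y in Ψ '' (Ψ ⁻¹' A ∩ V), h y :=
        (lintegral_image_eq_lintegral_abs_deriv_mul hs
          (fun t ht => (hd t ht.2).hasDerivWithinAt) (hinj.mono inter_subset_right) h).symm
    _ = ∫⁻ y in A ∩ Ψ '' V, h y := by rw [inter_comm, image_inter_preimage, inter_comm]
    _ = ∫⁻ y in A, h y := by
        rw [← lintegral_indicator (hA.inter hA2), ← lintegral_indicator hA, ← indicator_indicator,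
          indicator_eq_self.2 fun y hy => by_contra fun hy' => hy (hout y hy')]

/-- A differentiable function with non-vanishing derivative is injective on each piece of a
suitable countable measurable partition. -/
theorem exists_partition_injOn {Ψ Ψ' : ℝ → ℝ} {U : Set ℝ}
    (hd : ∀ t ∈ U, HasDerivAt Ψ (Ψ' t) t) (hd0 : ∀ t ∈ U, Ψ' t ≠ 0) :
    ∃ T : ℕ → Set ℝ, Pairwise (Function.onFun Disjoint T) ∧ (∀ n, MeasurableSet (T n)) ∧
      U ⊆ ⋃ n, T n ∧ ∀ n, InjOn Ψ (U ∩ T n) := by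
  classical
  -- A linear approximation with error below `‖A‖` forces injectivity. The value at `A = 0` only
  -- keeps `r` positive: on a piece meeting `U`, `A` is a derivative at a point of `U`, hence
  -- nonzero.
  let r : (ℝ →L[ℝ] ℝ) → NNReal := fun A => if A = 0 then 1 else ‖A‖₊ / 2
  obtain ⟨T, A, hdisj, hmeas, hcov, happ, hA⟩ :=
    exists_partition_approximatesLinearOn_of_hasFDerivWithinAt Ψ U
      (fun t => ContinuousLinearMap.toSpanSingleton ℝ (Ψ' t))
      (fun t ht => (hd t ht).hasFDerivAt.hasFDerivWithinAt) r (fun A => by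
        by_cases h : A = 0 <;> simp [r, h])
  refine ⟨T, hdisj, hmeas, hcov, fun n x hx y hy hxy => ?_⟩
  obtain ⟨z, hz, hAz⟩ := hA ⟨x, hx.1⟩ n
  have hpos : 0 < |Ψ' z| := abs_pos.2 (hd0 z hz)
  have hnorm : ‖A n‖ = |Ψ' z| := by rw [hAz]; simp
  have hne : A n ≠ 0 := by
    rw [← norm_ne_zero_iff, hnorm]
    exact hpos.ne'
  have hb := happ n x hx y hy
  simp only [r, hne, if_false] at hb
  rw [hxy, sub_self, zero_sub, norm_neg, NNReal.coe_div, coe_nnnorm, hnorm, hAz] at hb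
  simp only [ContinuousLinearMap.toSpanSingleton_apply, smul_eq_mul, norm_mul, Real.norm_eq_abs,
    NNReal.coe_ofNat] at hb
  have h0 : |x - y| = 0 := by
    by_contra hcon
    have : 0 < |x - y| := lt_of_le_of_ne (abs_nonneg _) (Ne.symm hcon)
    nlinarith [mul_pos hpos this]
  exact sub_eq_zero.1 (abs_eq_zero.1 h0)

/-- The image of `g(t) dt` under a function with non-vanishing derivative has density
`∑_{Ψ(t) = y} g(t) / |Ψ'(t)|`. -/
theorem map_withDensity_restrict_eq_tsum_fibre {Ψ Ψ' : ℝ → ℝ} {U : Set ℝ} (hU : MeasurableSet U)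
    (hΨ : Continuous Ψ) (hd : ∀ t ∈ U, HasDerivAt Ψ (Ψ' t) t) (hd0 : ∀ t ∈ U, Ψ' t ≠ 0)
    (hΨ' : Measurable Ψ') {g : ℝ → ENNReal} (hg : Measurable g) :
    Measurable (fun y => ∑' t : ↥(U ∩ Ψ ⁻¹' {y}), g t / ENNReal.ofReal |Ψ' t|) ∧
    ((volume.restrict U).withDensity g).map Ψ = volume.withDensity
      (fun y => ∑' t : ↥(U ∩ Ψ ⁻¹' {y}), g t / ENNReal.ofReal |Ψ' t|) := by
  obtain ⟨T, hdisj, hmeas, hcov, hinj⟩ := exists_partition_injOn hd hd0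
  have hpiece (n : ℕ) := map_withDensity_restrict_of_injOn (hU.inter (hmeas n)) hΨ
    (fun t ht => hd t ht.1) (fun t ht => hd0 t ht.1) hΨ' (hinj n) hg
  have hdisj' : Pairwise (Function.onFun Disjoint fun n => U ∩ T n) := fun i j hij =>
    (hdisj hij).mono inter_subset_right inter_subset_right
  have hUeq : U = ⋃ n, U ∩ T n := by
    rw [← inter_iUnion, inter_eq_left.2 hcov]
  have hsum : (fun y => ∑' t : ↥(U ∩ Ψ ⁻¹' {y}), g t / ENNReal.ofReal |Ψ' t|) =
      fun y => ∑' n, ∑' t : ↥(U ∩ T n ∩ Ψ ⁻¹' {y}), g t / ENNReal.ofReal |Ψ' t| := by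
    ext y
    rw [← ENNReal.tsum_biUnion (f := fun t => g t / ENNReal.ofReal |Ψ' t|)
      (t := fun n => U ∩ T n ∩ Ψ ⁻¹' {y})]
    · refine tsum_congr_set_coe (fun t => g t / ENNReal.ofReal |Ψ' t|) ?_
      rw [← iUnion_inter, ← hUeq]
    · exact fun i _ j _ hij => (hdisj' hij).mono inter_subset_left inter_subset_left
  rw [hsum]
  refine ⟨Measurable.tsum fun n => (hpiece n).1, ?_⟩
  have hwd := withDensity_tsum (μ := (volume : Measure ℝ)) fun n => (hpiece n).1
  have hfun : (∑' n, fun y => ∑' t : ↥(U ∩ T n ∩ Ψ ⁻¹' {y}), g t / ENNReal.ofReal |Ψ' t|) =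
      fun y => ∑' n, ∑' t : ↥(U ∩ T n ∩ Ψ ⁻¹' {y}), g t / ENNReal.ofReal |Ψ' t| := by
    ext y
    exact tsum_apply (Pi.summable.2 fun _ => ENNReal.summable)
  rw [hfun] at hwd
  rw [hwd]
  ext A hA
  have hA' : MeasurableSet (Ψ ⁻¹' A) := hΨ.measurable hA
  rw [Measure.map_apply hΨ.measurable hA, Measure.sum_apply _ hA, withDensity_apply _ hA',
    Measure.restrict_restrict hA']
  conv_lhs => rw [hUeq, inter_iUnion]
  rw [lintegral_iUnion (fun n => hA'.inter (hU.inter (hmeas n)))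
    (fun i j hij => (hdisj' hij).mono inter_subset_right inter_subset_right)]
  refine tsum_congr fun n => ?_
  rw [← (hpiece n).2, Measure.map_apply hΨ.measurable hA, withDensity_apply _ hA',
    Measure.restrict_restrict hA']

/-! ### The invariant measure -/

/-- The image on the circle of the measure `Γ'(t) dt` on `(0, 1]`. -/
noncomputable def phaseMeasure (Γ : ℝ → ℝ) : Measure UnitAddCircle :=
  ((volume.restrict (Ioc 0 1)).withDensity fun t => ENNReal.ofReal (deriv Γ t)).map
    ((↑) : ℝ → UnitAddCircle)

theorem IsC1Diffeo.bijective {f : ℝ → ℝ} (hf : IsC1Diffeo f) : Function.Bijective f := by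
  obtain ⟨g, -, hl, hr⟩ := hf.2
  exact ⟨hl.injective, hr.surjective⟩

theorem IsC1Diffeo.strictMono {Γ : ℝ → ℝ} (hΓ : IsC1Diffeo Γ)
    (hlift : ∀ t, Γ (t + 1) = Γ t + 1) : StrictMono Γ := by
  refine (hΓ.1.continuous.strictMono_of_inj hΓ.bijective.1).resolve_right fun h => ?_
  have := h (lt_add_one (0 : ℝ))
  rw [hlift] at this
  linarith

/-- Change of variables, with `|Γ'| = Γ'` by monotonicity; the image is again one full period. -/
theorem map_withDensity_deriv_Ioc {Γ : ℝ → ℝ} (hΓ : IsC1Diffeo Γ)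
    (hlift : ∀ t, Γ (t + 1) = Γ t + 1) :
    ((volume.restrict (Ioc 0 1)).withDensity fun t => ENNReal.ofReal (deriv Γ t)).map Γ =
      volume.restrict (Ioc (Γ 0) (Γ 0 + 1)) := by
  have hmono := hΓ.strictMono hlift
  have hdiff : Differentiable ℝ Γ := hΓ.1.differentiable one_ne_zero
  have himage : Γ '' Ioc 0 1 = Ioc (Γ 0) (Γ 0 + 1) := by
    have h1 : Γ 1 = Γ 0 + 1 := by simpa using hlift 0
    rw [← h1]
    ext y
    obtain ⟨t, rfl⟩ := hΓ.bijective.2 y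
    simp [hmono.injective.eq_iff, hmono.lt_iff_lt, hmono.le_iff_le]
  ext A hA
  have hA' : MeasurableSet (Γ ⁻¹' A) := hdiff.continuous.measurable hA
  have hs : MeasurableSet (Γ ⁻¹' A ∩ Ioc 0 1) := hA'.inter measurableSet_Ioc
  rw [Measure.map_apply hdiff.continuous.measurable hA, withDensity_apply _ hA',
    Measure.restrict_restrict hA', Measure.restrict_apply hA, ← himage,
    ← image_preimage_inter, ← setLIntegral_one,
    lintegral_image_eq_lintegral_abs_deriv_mul hs
      (fun t _ => (hdiff t).hasDerivAt.hasDerivWithinAt) hmono.injective.injOn]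
  refine lintegral_congr fun t => ?_
  rw [mul_one, abs_of_nonneg hmono.monotone.deriv_nonneg]

theorem map_phaseMap_phaseMeasure {Γ : ℝ → ℝ} (hΓ : IsC1Diffeo Γ)
    (hlift : ∀ t, Γ (t + 1) = Γ t + 1) :
    (phaseMeasure Γ).map (phaseMap Γ) = volume := by
  have hm : Measurable Γ := hΓ.1.continuous.measurable
  have hcomp : phaseMap Γ ∘ ((↑) : ℝ → UnitAddCircle) = ((↑) : ℝ → UnitAddCircle) ∘ Γ :=
    funext fun t => phaseMap_coe hlift t
  rw [phaseMeasure, Measure.map_map (measurable_phaseMap hm) AddCircle.measurable_mk', hcomp,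
    ← Measure.map_map AddCircle.measurable_mk' hm, map_withDensity_deriv_Ioc hΓ hlift]
  exact (AddCircle.measurePreserving_mk 1 (Γ 0)).map_eq

/-- The circle map of a diffeomorphism of degree one acts injectively on measures. -/
theorem map_phaseMap_injective {Γ : ℝ → ℝ} (hΓ : IsC1Diffeo Γ)
    (hlift : ∀ t, Γ (t + 1) = Γ t + 1) :
    Function.Injective fun ν : Measure UnitAddCircle => ν.map (phaseMap Γ) := by
  obtain ⟨g, hg, hl, hr⟩ := hΓ.2
  -- The inverse also has degree one, so it descends to the circle and inverts `phaseMap Γ` there.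
  have hglift (t : ℝ) : g (t + 1) = g t + 1 := by
    apply hl.injective
    rw [hlift, hr, hr]
  have hinv : phaseMap g ∘ phaseMap Γ = id := by
    ext z
    rw [Function.comp_apply, phaseMap_phaseMap hglift, hl.comp_eq_id]
    exact coe_rep z
  refine Function.LeftInverse.injective (g := fun ν => ν.map (phaseMap g)) fun ν => ?_
  simp only
  rw [Measure.map_map (measurable_phaseMap hg.continuous.measurable)
    (measurable_phaseMap hΓ.1.continuous.measurable), hinv, Measure.map_id]

/-- A circle map conjugate to an irrational rotation is uniquely ergodic. -/
theorem isInvariantProb_iff_eq_phaseMeasure {Φ Γ : ℝ → ℝ} (hΦ : IsC1Diffeo Φ) {ρ : ℝ}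
    (hirr : Irrational ρ) (hΓ : IsC1Diffeo Γ) (hlift : ∀ t, Γ (t + 1) = Γ t + 1)
    (hconj : ∀ t, Γ (Φ t) = Γ t + ρ) (ν : Measure UnitAddCircle) :
    IsInvariantProb Φ ν ↔ ν = phaseMeasure Γ := by
  have hmΓ := measurable_phaseMap hΓ.1.continuous.measurable
  have hmΦ := measurable_phaseMap hΦ.1.continuous.measurable
  have hcomm : phaseMap Γ ∘ phaseMap Φ = (· + (ρ : UnitAddCircle)) ∘ phaseMap Γ := by
    ext z
    rw [Function.comp_apply, phaseMap_phaseMap hlift]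
    simp [phaseMap, hconj]
  have hrot (ν : Measure UnitAddCircle) :
      (ν.map (phaseMap Φ)).map (phaseMap Γ) =
        (ν.map (phaseMap Γ)).map (· + (ρ : UnitAddCircle)) := by
    rw [Measure.map_map hmΓ hmΦ, hcomm, ← Measure.map_map (measurable_add_const _) hmΓ]
  constructor
  · rintro ⟨hν, hinv⟩
    apply map_phaseMap_injective hΓ hlift
    simp only
    have : IsProbabilityMeasure (ν.map (phaseMap Γ)) :=
      Measure.isProbabilityMeasure_map hmΓ.aemeasurable
    rw [map_phaseMap_phaseMeasure hΓ hlift]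
    exact eq_volume_of_map_add_irrational hirr (by rw [← hrot, hinv.map_eq])
  · rintro rfl
    have hvol := map_phaseMap_phaseMeasure hΓ hlift
    -- By injectivity, invariance may be checked after pushing forward, where it is rotation
    -- invariance of Haar measure.
    refine ⟨⟨?_⟩, hmΦ, map_phaseMap_injective hΓ hlift ?_⟩
    · have huniv := congrArg (fun m => m univ) hvol
      simpa [Measure.map_apply hmΓ MeasurableSet.univ] using huniv
    · simp only
      rw [hrot, hvol, map_add_right_eq_self]

/-! ### The interspike-interval distribution -/

/-- Since `Ψ` is 1-periodic, the passage through the circle and back via `rep` has no effect. -/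
theorem isiDistribution_phaseMeasure {Φ : ℝ → ℝ} (hΦ : Measurable Φ)
    (hlift : ∀ t, Φ (t + 1) = Φ t + 1) (Γ : ℝ → ℝ) :
    isiDistribution Φ (phaseMeasure Γ) =
      ((volume.restrict (Ioc 0 1)).withDensity fun t => ENNReal.ofReal (deriv Γ t)).map
        (displacement Φ) := by
  have hm : Measurable (displacement Φ) := hΦ.sub measurable_id
  have hper : Function.Periodic (displacement Φ) 1 := fun t => by
    simp only [displacement, hlift]
    ring
  rw [isiDistribution, phaseMeasure, Measure.map_map (by exact hm.comp measurable_rep)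
    AddCircle.measurable_mk']
  congr 1
  exact funext fun t => periodic_apply_rep hper t

theorem deriv_displacement {Φ : ℝ → ℝ} (hΦ : Differentiable ℝ Φ) (t : ℝ) :
    deriv (displacement Φ) t = deriv Φ t - 1 := by
  simpa using! ((hΦ t).hasDerivAt.sub (hasDerivAt_id t)).deriv

/-- Differentiable maps of the line send null sets to null sets. -/
theorem volume_criticalValues_eq_zero {Φ : ℝ → ℝ} (hΦ : Differentiable ℝ Φ)
    (hcrit : volume (criticalSet Φ) = 0) : volume (criticalValues Φ) = 0 :=
  addHaar_image_eq_zero_of_differentiableOn_of_addHaar_eq_zero volume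
    (hΦ.sub differentiable_id).differentiableOn hcrit

theorem deriv_displacement_ne_zero_of_mem_fibre {Φ : ℝ → ℝ} {y t : ℝ}
    (hy : y ∉ criticalValues Φ) (ht : t ∈ fibre Φ y) : deriv (displacement Φ) t ≠ 0 :=
  fun h => hy ⟨t, ⟨ht.1, h⟩, ht.2⟩

/-- An infinite fibre would accumulate in `[0, 1]` at one of its own points, but a nonzero
derivative there keeps `Ψ ≠ y` on a punctured neighbourhood. -/
theorem finite_fibre {Φ : ℝ → ℝ} (hΦ : Differentiable ℝ Φ) {y : ℝ}
    (hy : y ∉ criticalValues Φ) : (fibre Φ y).Finite := by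
  have hd : Differentiable ℝ (displacement Φ) := hΦ.sub differentiable_id
  by_contra hinf
  obtain ⟨t, ht, hacc⟩ := Set.Infinite.exists_accPt_of_subset_isCompact hinf
    (isCompact_Icc (a := (0 : ℝ)) (b := 1)) fun t ht => ht.1
  rw [accPt_iff_frequently_nhdsNE] at hacc
  have hty : t ∈ fibre Φ y := by
    have hclosed : IsClosed (fibre Φ y) :=
      isClosed_Icc.inter (isClosed_singleton.preimage hd.continuous)
    rw [← hclosed.closure_eq, mem_closure_iff_frequently]
    exact hacc.filter_mono nhdsWithin_le_nhds
  have hne := (hd t).hasDerivAt.eventually_ne (c := y)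
    (deriv_displacement_ne_zero_of_mem_fibre hy hty)
  exact hacc (hne.mono fun z hz hz' => hz hz'.2)

theorem isiDensity_nonneg {Φ Γ : ℝ → ℝ} (hΓ : Monotone Γ) (m : Measure ℝ) (y : ℝ) :
    0 ≤ isiDensity Φ Γ m y := by
  unfold isiDensity
  split_ifs
  · exact tsum_nonneg fun t => mul_nonneg hΓ.deriv_nonneg (by positivity)
  · exact le_rfl

/-- Off the critical values the real sum over the fibre agrees with the extended one. -/
theorem ofReal_tsum_fibre {Φ Γ : ℝ → ℝ} (hΦ : Differentiable ℝ Φ) (hΓ : Monotone Γ) {y : ℝ}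
    (hy : y ∉ criticalValues Φ) :
    ENNReal.ofReal (∑' t : fibre Φ y, deriv Γ t * (1 / |deriv Φ t - 1|)) =
      ∑' t : fibre Φ y,
        ENNReal.ofReal (deriv Γ t) / ENNReal.ofReal |deriv (displacement Φ) t| := by
  have := (finite_fibre hΦ hy).to_subtype
  rw [ENNReal.ofReal_tsum_of_nonneg
    (fun t => mul_nonneg hΓ.deriv_nonneg (by positivity)) (Summable.of_finite)]
  refine tsum_congr fun t => ?_
  have hne := deriv_displacement_ne_zero_of_mem_fibre hy t.2
  rw [← ENNReal.ofReal_div_of_pos (abs_pos.2 hne), deriv_displacement hΦ, mul_one_div]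

/-- The interspike-interval distribution has density `isiDensity`. -/
theorem isiDensity_spec {Φ Γ : ℝ → ℝ} (hΦ : ContDiff ℝ 1 Φ)
    (hlift : ∀ t, Φ (t + 1) = Φ t + 1) (hΓ : ContDiff ℝ 1 Γ) (hmono : Monotone Γ)
    (hcrit : volume (criticalSet Φ) = 0) :
    AEMeasurable (isiDensity Φ Γ (isiDistribution Φ (phaseMeasure Γ))) volume ∧
    isiDistribution Φ (phaseMeasure Γ) = volume.withDensity fun y =>
      ENNReal.ofReal (isiDensity Φ Γ (isiDistribution Φ (phaseMeasure Γ)) y) := by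
  have hdiff : Differentiable ℝ Φ := hΦ.differentiable one_ne_zero
  have hΨ : ContDiff ℝ 1 (displacement Φ) := hΦ.sub contDiff_id
  have hΨd : Differentiable ℝ (displacement Φ) := hΨ.differentiable one_ne_zero
  have hΨ' : Continuous (deriv (displacement Φ)) := hΨ.continuous_deriv le_rfl
  -- Both endpoints are dropped: the fibre over `[0, 1]` contains both or neither, so it differs
  -- from that of `U` only at critical values and at `y = Ψ 0 = Ψ 1`.
  set U : Set ℝ := Ioo 0 1 ∩ {t | deriv (displacement Φ) t ≠ 0} with hU
  have hUm : MeasurableSet U :=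
    measurableSet_Ioo.inter (isOpen_ne_fun hΨ' continuous_const).measurableSet
  have hUae : (Ioc 0 1 : Set ℝ) =ᵐ[volume] U := by
    have h1 : ∀ᵐ t : ℝ, t ∉ criticalSet Φ := measure_eq_zero_iff_ae_notMem.1 hcrit
    have h2 : ∀ᵐ t : ℝ, t ≠ 1 := by simp [ae_iff]
    filter_upwards [h1, h2] with t ht ht1
    refine propext ⟨fun h => ⟨⟨h.1, lt_of_le_of_ne h.2 ht1⟩, fun h0 => ?_⟩,
      fun h => Ioo_subset_Ioc_self h.1⟩
    exact ht ⟨Ioc_subset_Icc_self h, h0⟩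
  obtain ⟨hm, heq⟩ := map_withDensity_restrict_eq_tsum_fibre hUm hΨd.continuous
    (fun t _ => (hΨd t).hasDerivAt) (fun t ht => ht.2) hΨ'.measurable
    (g := fun t => ENNReal.ofReal (deriv Γ t))
    (hΓ.continuous_deriv le_rfl).measurable.ennreal_ofReal
  rw [← Measure.restrict_congr_set hUae,
    ← isiDistribution_phaseMeasure hΦ.continuous.measurable hlift] at heq
  set m := isiDistribution Φ (phaseMeasure Γ)
  set h : ℝ → ENNReal := fun y => ∑' t : ↥(U ∩ displacement Φ ⁻¹' {y}),
    ENNReal.ofReal (deriv Γ t) / ENNReal.ofReal |deriv (displacement Φ) t|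
  -- The complement of the support is `m`-null, so the density `h` integrates to zero over it.
  have hoff : ∀ᵐ y, y ∈ m.supportᶜ → h y = 0 := by
    have hsm : MeasurableSet m.supportᶜ := Measure.isOpen_compl_support.measurableSet
    have h0 : m m.supportᶜ = 0 := Measure.measure_compl_support
    have h1 : ∫⁻ y in m.supportᶜ, h y = 0 := by rw [← withDensity_apply _ hsm, ← heq, h0]
    exact (ae_restrict_iff' hsm).1 ((lintegral_eq_zero_iff hm).1 h1)
  have hae : (fun y => ENNReal.ofReal (isiDensity Φ Γ m y)) =ᵐ[volume] h := by
    have h1 : ∀ᵐ y, y ∉ criticalValues Φ :=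
      measure_eq_zero_iff_ae_notMem.1 (volume_criticalValues_eq_zero hdiff hcrit)
    have h2 : ∀ᵐ y, y ≠ displacement Φ 0 := by simp [ae_iff]
    filter_upwards [h1, h2, hoff] with y hy hy0 hyoff
    by_cases hs : y ∈ m.support
    · rw [isiDensity, if_pos hs, ofReal_tsum_fibre hdiff hmono hy]
      refine tsum_congr_set_coe (fun t => ENNReal.ofReal (deriv Γ t) /
        ENNReal.ofReal |deriv (displacement Φ) t|) ?_
      have h10 : displacement Φ 1 = displacement Φ 0 := by
        have := hlift 0
        simp only [displacement]
        rw [zero_add] at this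
        rw [this]
        ring
      ext t
      refine ⟨fun ht => ⟨⟨⟨lt_of_le_of_ne ht.1.1 ?_, lt_of_le_of_ne ht.1.2 ?_⟩,
        deriv_displacement_ne_zero_of_mem_fibre hy ht⟩, ht.2⟩,
        fun ht => ⟨Ioo_subset_Icc_self ht.1.1, ht.2⟩⟩
      · rintro rfl
        exact hy0 ht.2.symm
      · rintro rfl
        exact hy0 (ht.2.symm.trans h10)
    · rw [isiDensity, if_neg hs, ENNReal.ofReal_zero, hyoff hs]
  refine ⟨⟨fun y => (h y).toReal, hm.ennreal_toReal, ?_⟩, ?_⟩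
  · filter_upwards [hae] with y hy
    rw [← hy, ENNReal.toReal_ofReal (isiDensity_nonneg hmono m y)]
  · rw [withDensity_congr_ae hae]
    exact heq

end IntegrateFire

theorem mainTheorem8 (F : ℝ → ℝ → ℝ)
    (hper : ∀ t x : ℝ, F (t + 1) x = F t x)
    (hwp : IntegrateFire.WellPosed F)
    (hdom : IntegrateFire.firingDomain F = Set.univ)
    (Φ : ℝ → ℝ) (hfire : Φ = IntegrateFire.firingMap F)
    (hΦ : IntegrateFire.IsC1Diffeo Φ)
    (ρ : ℝ) (hρ : IntegrateFire.HasRotationNumber Φ ρ) (hirr : Irrational ρ)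
    (Γ : ℝ → ℝ) (hΓ : IntegrateFire.IsC1Diffeo Γ)
    (hΓlift : ∀ t : ℝ, Γ (t + 1) = Γ t + 1)
    (hconj : ∀ t : ℝ, Γ (Φ t) = Γ t + ρ)
    (hcrit : MeasureTheory.volume (IntegrateFire.criticalSet Φ) = 0) :
    -- the invariant probability measure of the circle map exists and is unique
    ∃ μ : MeasureTheory.Measure UnitAddCircle,
      (∀ ν : MeasureTheory.Measure UnitAddCircle,
        IntegrateFire.IsInvariantProb Φ ν ↔ ν = μ) ∧
      -- the interspike-interval distribution is absolutely continuous
      (IntegrateFire.isiDistribution Φ μ).AbsolutelyContinuous MeasureTheory.volume ∧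
      -- its density is the stated function
      AEMeasurable (IntegrateFire.isiDensity Φ Γ (IntegrateFire.isiDistribution Φ μ))
        MeasureTheory.volume ∧
      IntegrateFire.isiDistribution Φ μ =
        MeasureTheory.volume.withDensity (fun y =>
          ENNReal.ofReal
            (IntegrateFire.isiDensity Φ Γ (IntegrateFire.isiDistribution Φ μ) y)) ∧
      -- the formula is well-defined off the critical values, hence almost everywhere
      MeasureTheory.volume (IntegrateFire.criticalValues Φ) = 0 ∧
      (∀ y ∈ (IntegrateFire.isiDistribution Φ μ).support \ IntegrateFire.criticalValues Φ,
        (IntegrateFire.fibre Φ y).Finite ∧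
          ∀ t ∈ IntegrateFire.fibre Φ y, deriv Φ t ≠ 1) := by
  -- Both sides have the same image under the injective `Γ`.
  have hlift (t : ℝ) : Φ (t + 1) = Φ t + 1 := by
    apply hΓ.bijective.1
    rw [hconj, hΓlift, hΓlift, hconj]
    ring
  have hdiff : Differentiable ℝ Φ := hΦ.1.differentiable one_ne_zero
  obtain ⟨hmeas, hdens⟩ := IntegrateFire.isiDensity_spec hΦ.1 hlift hΓ.1
    (hΓ.strictMono hΓlift).monotone hcrit
  refine ⟨IntegrateFire.phaseMeasure Γ,
    IntegrateFire.isInvariantProb_iff_eq_phaseMeasure hΦ hirr hΓ hΓlift hconj, ?_, hmeas, hdens,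
    IntegrateFire.volume_criticalValues_eq_zero hdiff hcrit, fun y hy =>
      ⟨IntegrateFire.finite_fibre hdiff hy.2, fun t ht h1 => ?_⟩⟩
  · rw [hdens]
    exact withDensity_absolutelyContinuous _ _
  · apply IntegrateFire.deriv_displacement_ne_zero_of_mem_fibre hy.2 ht
    rw [IntegrateFire.deriv_displacement hdiff, h1, sub_self]
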